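/- Let $\big(Y_1(t),Y_2(t)\big)^\top$, $t\ge 0$, be the two-dimensional real stationary Ornstein–Uhlenbeck process with damping parameter $\lambda>0$, frequency $\omega\neq 0$ and $\sigma>0$, that is, the centred stationary Gaussian process solving $$\mathrm d\begin{bmatrix}Y_1(t)\\Y_2(t)\end{bmatrix}=\begin{bmatrix}-\lambda&-\omega\\ \omega&-\lambda\end{bmatrix}\begin{bmatrix}Y_1(t)\\Y_2(t)\end{bmatrix}\mathrm dt+\sigma\begin{bmatrix}\mathrm d\mathcal W_1(t)\\ \mathrm d\mathcal W_2(t)\end{bmatrix}$$ with independent standard Brownian motions $\mathcal W_1,\mathcal W_2$; its law is determined by $$\mathsf E\begin{bmatrix}Y_1(t+\tau)\\Y_2(t+\tau)\end{bmatrix}\begin{bmatrix}Y_1(t)\\Y_2(t)\end{bmatrix}^{\top}=\frac{\sigma^2}{2\lambda}\,\mathrm e^{-\lambda\tau}\begin{bmatrix}\cos(\omega\tau)&-\sin(\omega\tau)\\ \sin(\omega\tau)&\cos(\omega\tau)\end{bmatrix},\qquad t,\tau\ge 0 .$$ Normalize $\sigma^2=2\lambda$ for all parameter values, so that $Y_1(t),Y_2(t)$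 have variance one. For constants $m_1,m_2\in\mathbb R$ let $Z_1(t)=m_1+Y_1(t)$, $Z_2(t)=m_2+Y_2(t)$, and let $C(n)=C(n;\lambda,\omega)$ be the $2n\times 2n$ covariance matrix of the observations $\big(Z_1(t_1),Z_2(t_1),\dots,Z_1(t_n),Z_2(t_n)\big)^\top$ in design points $0\le t_1<t_2<\dots<t_n$. The Fisher information matrix of this Gaussian observation vector on the covariance parameters $(\lambda,\omega)$ is $$\mathcal I_{\lambda,\omega}(n)=\begin{bmatrix}\mathcal I_\lambda(n)& I_{\lambda,\omega}(n)\\ I_{\lambda,\omega}(n)&\mathcal I_\omega(n)\end{bmatrix},$$ with entries defined by $$\mathcal I_\lambda(n)=\tfrac12\operatorname{tr}\Big\{C^{-1}(n)\tfrac{\partial C(n)}{\partial\lambda}C^{-1}(n)\tfrac{\partial C(n)}{\partial\lambda}\Big\},\quad \mathcal I_\omega(n)=\tfrac12\operatorname{tr}\Big\{C^{-1}(n)\tfrac{\partial C(n)}{\partial\omega}C^{-1}(n)\tfrac{\partial C(n)}{\partial\omega}\Big\},$$ $$I_{\lambda,\omega}(n)=\tfrac12\operatorname{tr}\Big\{C^{-1}(n)\tfrac{\partial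 C(n)}{\partial\lambda}C^{-1}(n)\tfrac{\partial C(n)}{\partial\omega}\Big\}.$$ Then $C(n)$ is positive definite and its entries have partial derivatives with respect to $\lambda$ and $\omega$, and, with $d_\ell=t_{\ell+1}-t_\ell$, $\ell=1,\dots,n-1$, $$\mathcal I_\lambda(n)=\sum_{\ell=1}^{n-1}\varphi(d_\ell),\qquad \mathcal I_\omega(n)=\sum_{\ell=1}^{n-1}\psi(d_\ell),\qquad I_{\lambda,\omega}(n)=0,$$ where $$\varphi(x)=\frac{x^2\mathrm e^{-\lambda x}\cosh(\lambda x)}{\sinh^2(\lambda x)},\qquad \psi(x)=\frac{x^2\mathrm e^{-\lambda x}}{\sinh(\lambda x)}\qquad (x>0),\qquad \varphi(0)=\frac1{\lambda^2},\quad\psi(0)=0 .$$ In particular the matrix $\mathcal I_{\lambda,\omega}(n)$ does not depend on $\omega$. -/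

import Mathlib

open MeasureTheory ProbabilityTheory
open scoped NNReal

noncomputable section

/-- The matrix `σ² / (2 λ) · e^{-λ τ} · [[cos (ω τ), -sin (ω τ)], [sin (ω τ), cos (ω τ)]]`, i.e.
`σ² / (2 λ) · e^{A τ}` with `A = [[-λ, -ω], [ω, -λ]]`, for `τ ≥ 0`. -/
def ouCov (lam om sigma : ℝ) (τ : ℝ≥0) : Matrix (Fin 2) (Fin 2) ℝ :=
  (sigma ^ 2 / (2 * lam) * Real.exp (-lam * τ)) •
    !![Real.cos (om * τ), -Real.sin (om * τ); Real.sin (om * τ), Real.cos (om * τ)]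

/-- `Y` is (under `P`) a two-dimensional stationary Ornstein–Uhlenbeck process with damping
parameter `λ`, frequency `ω` and standard deviation `σ`, i.e. it has the finite-dimensional
distributions of the stationary solution of `dY = A Y dt + σ dW`: it is a centred Gaussian process
with `E [Y(t + τ) Y(t)ᵀ] = σ² / (2 λ) · e^{A τ}` for all `t, τ ≥ 0`. -/
structure IsStationaryOU {Ω : Type*} [MeasurableSpace Ω] (lam om sigma : ℝ)
    (Y : ℝ≥0 → Ω → EuclideanSpace ℝ (Fin 2)) (P : Measure Ω) : Prop where
  gaussian : IsGaussianProcess Y P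
  centered : ∀ (t : ℝ≥0) (i : Fin 2), ∫ w, Y t w i ∂P = 0
  cov_eq : ∀ (t τ : ℝ≥0) (i j : Fin 2),
    ∫ w, Y (t + τ) w i * Y t w j ∂P = ouCov lam om sigma τ i j

/-- The process with constant trend `m`: `Z₁(t) = m₁ + Y₁(t)`, `Z₂(t) = m₂ + Y₂(t)`. -/
def constTrend {Ω : Type*} (m : EuclideanSpace ℝ (Fin 2))
    (Y : ℝ≥0 → Ω → EuclideanSpace ℝ (Fin 2)) (t : ℝ≥0) (w : Ω) : EuclideanSpace ℝ (Fin 2) :=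
  m + Y t w

/-- The `2n × 2n` covariance matrix of the observations
`(Z₁(t₁), Z₂(t₁), …, Z₁(tₙ), Z₂(tₙ))`; the index `(j, i)` stands for the entry `Zᵢ(tⱼ)`. -/
def obsCov {Ω : Type*} [MeasurableSpace Ω] {n : ℕ} (Z : ℝ≥0 → Ω → EuclideanSpace ℝ (Fin 2))
    (P : Measure Ω) (t : Fin n → ℝ≥0) : Matrix (Fin n × Fin 2) (Fin n × Fin 2) ℝ :=
  Matrix.of fun p q => covariance (fun w => Z (t p.1) w p.2) (fun w => Z (t q.1) w q.2) P

/-- The partial derivative of a matrix function of `(λ, ω)` with respect to `λ`. -/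
def matDerivLam {ι : Type*} (C : ℝ → ℝ → Matrix ι ι ℝ) (lam om : ℝ) : Matrix ι ι ℝ :=
  Matrix.of fun p q => deriv (fun l => C l om p q) lam

/-- The partial derivative of a matrix function of `(λ, ω)` with respect to `ω`. -/
def matDerivOm {ι : Type*} (C : ℝ → ℝ → Matrix ι ι ℝ) (lam om : ℝ) : Matrix ι ι ℝ :=
  Matrix.of fun p q => deriv (fun o => C lam o p q) om

/-- `1/2 · tr (C⁻¹ C₁ C⁻¹ C₂)`. -/
def fisherEntry {ι : Type*} [Fintype ι] [DecidableEq ι] (C C₁ C₂ : Matrix ι ι ℝ) : ℝ :=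
  1 / 2 * (C⁻¹ * C₁ * C⁻¹ * C₂).trace

/-- The Fisher information matrix on the covariance parameters `(λ, ω)` of a Gaussian observation
vector with covariance matrix `C λ ω`. -/
def fisherMatrix {ι : Type*} [Fintype ι] [DecidableEq ι] (C : ℝ → ℝ → Matrix ι ι ℝ)
    (lam om : ℝ) : Matrix (Fin 2) (Fin 2) ℝ :=
  !![fisherEntry (C lam om) (matDerivLam C lam om) (matDerivLam C lam om),
     fisherEntry (C lam om) (matDerivLam C lam om) (matDerivOm C lam om);
     fisherEntry (C lam om) (matDerivLam C lam om) (matDerivOm C lam om),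
     fisherEntry (C lam om) (matDerivOm C lam om) (matDerivOm C lam om)]

/-- The distance of the consecutive design points with the (zero-based) numbers `ℓ`, `ℓ + 1`. -/
def gap {n : ℕ} (t : Fin n → ℝ≥0) (l : Fin (n - 1)) : ℝ :=
  (t ⟨l.1 + 1, by omega⟩ : ℝ) - (t ⟨l.1, by omega⟩ : ℝ)

/-- `φ(x) = x² e^{-λ x} cosh (λ x) / sinh² (λ x)` for `x > 0`, and `φ(0) = 1 / λ²`. -/
def phiOU (lam x : ℝ) : ℝ :=
  if x = 0 then 1 / lam ^ 2
  else x ^ 2 * Real.exp (-lam * x) * Real.cosh (lam * x) / Real.sinh (lam * x) ^ 2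

/-- `ψ(x) = x² e^{-λ x} / sinh (λ x)` for `x > 0`, and `ψ(0) = 0`. -/
def psiOU (lam x : ℝ) : ℝ :=
  if x = 0 then 0 else x ^ 2 * Real.exp (-lam * x) / Real.sinh (lam * x)

end

/-! Over the planar factor the covariance is a rotated Kronecker product: with `K` the kernel
e^{-λ|t_p - t_q|} and `R` the block diagonal rotation by the angles ω t_p, one has C = R (K ⊗ 1) Rᵀ,
since R(ωs) R(ωu)ᵀ = R(ω(s - u)). Both derivatives have the same shape: ∂C/∂λ = R (K' ⊗ 1) Rᵀ and
∂C/∂ω = R (M ⊗ J) Rᵀ, where M has entries (t_p - t_q) K_pq and J is the quarter turn. The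
information entries are invariant under congruence, so `R` and with it ω drop out, and each trace
splits into a scalar trace times tr 1 = 2, tr J² = -2 or tr J = 0 (`fisherEntry_blockRot`). The last
value kills the mixed entry.

The scalar traces are computed by removing the last design point. By the Markov property, one
elementary congruence with a = e^{-λd} turns K into the block diagonal of the previous kernel and
the innovation variance 1 - a². The same congruence leaves K' and M bordered by multiples of a
column of the previous kernel, so `trace_bordered` gives the contribution of one gap without
inverting that kernel. -/

namespace Matrix

/-! ### Congruences and bordered matrices -/

theorem trace_fromBlocks {ι κ : Type*} [Fintype ι] [Fintype κ] (A : Matrix ι ι ℝ)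
    (B : Matrix ι κ ℝ) (B' : Matrix κ ι ℝ)
    (D : Matrix κ κ ℝ) : (fromBlocks A B B' D).trace = A.trace + D.trace := by
  simp [trace]

variable {ι : Type*} [Fintype ι] [DecidableEq ι]

/-- The factors `L` cancel inside the product, which leaves a conjugation by `Lᵀ`; the trace does
not see it. -/
theorem trace_inv_mul_congr (L D G G' : Matrix ι ι ℝ) (hL : IsUnit L.det) :
    ((L * D * Lᵀ)⁻¹ * (L * G * Lᵀ) * (L * D * Lᵀ)⁻¹ * (L * G' * Lᵀ)).trace =
      (D⁻¹ * G * D⁻¹ * G').trace := by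
  have hLt : IsUnit Lᵀ.det := by rwa [det_transpose]
  have h1 : (L * D * Lᵀ)⁻¹ * (L * G * Lᵀ) * (L * D * Lᵀ)⁻¹ * (L * G' * Lᵀ) =
      Lᵀ⁻¹ * (D⁻¹ * G * D⁻¹ * G' * Lᵀ) := by
    simp only [mul_inv_rev, Matrix.mul_assoc]
    simp only [nonsing_inv_mul_cancel_left _ _ hL, mul_nonsing_inv_cancel_left _ _ hLt]
  rw [h1, trace_mul_comm, Matrix.mul_assoc, mul_nonsing_inv _ hLt, Matrix.mul_one]

theorem posDef_congr (L D : Matrix ι ι ℝ) (hL : IsUnit L.det) (hD : D.PosDef) :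
    (L * D * Lᵀ).PosDef := by
  have h := hD.mul_mul_conjTranspose_same (B := L)
    (vecMul_injective_of_isUnit ((isUnit_iff_isUnit_det L).2 hL))
  rwa [conjTranspose_eq_transpose_of_trivial] at h

/-- The unipotent block matrix `[[1, 0], [a eₓᵀ, 1]]`. -/
def appendRow (x : ι) (a : ℝ) : Matrix (ι ⊕ Fin 1) (ι ⊕ Fin 1) ℝ :=
  fromBlocks 1 0 (of fun _ j => if j = x then a else 0) 1

theorem isUnit_det_appendRow (x : ι) (a : ℝ) : IsUnit (appendRow x a).det := by
  simp [appendRow]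

theorem appendRow_congr (x : ι) (a : ℝ) (A : Matrix ι ι ℝ) (B : Matrix ι (Fin 1) ℝ)
    (B' : Matrix (Fin 1) ι ℝ) (w : ℝ) :
    appendRow x a * fromBlocks A B B' (of fun _ _ => w) * (appendRow x a)ᵀ =
      fromBlocks A (of fun i _ => a * A i x + B i 0) (of fun _ j => a * A x j + B' 0 j)
        (of fun _ _ => a * (a * A x x + B x 0 + B' 0 x) + w) := by
  have e1 : ∀ (M : Matrix ι ι ℝ), (of fun (_ : Fin 1) j => if j = x then a else 0) * M =
      of fun _ j => a * M x j := by
    intro M; ext i j; simp [mul_apply]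
  have e1' : ∀ (M : Matrix ι (Fin 1) ℝ), (of fun (_ : Fin 1) j => if j = x then a else 0) * M =
      of fun _ j => a * M x j := by
    intro M; ext i j; simp [mul_apply]
  have e2 : ∀ (M : Matrix ι ι ℝ), M * (of fun (_ : Fin 1) j => if j = x then a else 0)ᵀ =
      of fun i _ => a * M i x := by
    intro M; ext i j; simp [mul_apply, mul_comm]
  have e2' : ∀ (M : Matrix (Fin 1) ι ℝ), M * (of fun (_ : Fin 1) j => if j = x then a else 0)ᵀ =
      of fun i _ => a * M i x := by
    intro M; ext i j; simp [mul_apply, mul_comm]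
  simp only [appendRow, fromBlocks_transpose, fromBlocks_multiply, transpose_one, transpose_zero,
    Matrix.one_mul, Matrix.mul_one, Matrix.zero_mul, Matrix.mul_zero, add_zero,
    e1, e1', e2, e2']
  congr 1
  · ext i j; fin_cases j; simp
  · ext i j; fin_cases i; simp
  · ext i j; fin_cases i; fin_cases j; simp; ring

/-- The border is `c` times column `x` of `K`, so `K⁻¹` sends it to `c` times a unit vector and the
cross terms need only `K x x = 1`. The sign `ε` covers the symmetric (`1`) and the antisymmetric
(`-1`) case. -/
theorem trace_bordered (x : ι) (K S : Matrix ι ι ℝ) (hK : IsUnit K.det) (hKx : K x x = 1)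
    (s c ε w : ℝ) (hs : s ≠ 0) :
    ((fromBlocks K 0 0 (of fun _ _ => s) : Matrix (ι ⊕ Fin 1) (ι ⊕ Fin 1) ℝ)⁻¹ *
      fromBlocks S (of fun i _ => c * K i x) (of fun _ j => ε * (c * K x j)) (of fun _ _ => w) *
      (fromBlocks K 0 0 (of fun _ _ => s))⁻¹ *
      fromBlocks S (of fun i _ => c * K i x) (of fun _ j => ε * (c * K x j))
        (of fun _ _ => w)).trace =
      (K⁻¹ * S * K⁻¹ * S).trace + 2 * ε * c ^ 2 / s + w ^ 2 / s ^ 2 := by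
  have hinv : (fromBlocks K 0 0 (of fun _ _ => s) : Matrix (ι ⊕ Fin 1) (ι ⊕ Fin 1) ℝ)⁻¹ =
      fromBlocks K⁻¹ 0 0 (of fun _ _ => s⁻¹) := by
    apply inv_eq_right_inv
    rw [fromBlocks_multiply, ← fromBlocks_one]
    simp only [Matrix.zero_mul, Matrix.mul_zero, add_zero, zero_add, mul_nonsing_inv _ hK]
    congr 1
    ext i j; fin_cases i; fin_cases j; simp [mul_apply, hs]
  have e1 : K⁻¹ * (of fun i (_ : Fin 1) => c * K i x) = of fun i _ => if i = x then c else 0 := by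
    ext i j
    have := congrFun (congrFun (nonsing_inv_mul _ hK) i) x
    rw [mul_apply] at this
    simp only [mul_apply, of_apply]
    rw [Finset.sum_congr rfl (fun k _ => mul_left_comm (K⁻¹ i k) c (K k x)), ← Finset.mul_sum, this,
      one_apply]
    simp
  have e2 : (of fun (_ : Fin 1) j => ε * (c * K x j)) * (of fun i (_ : Fin 1) =>
      if i = x then c else 0) = of fun _ _ => ε * c ^ 2 := by
    ext i j
    simp [mul_apply, hKx]; ring
  rw [hinv, Matrix.mul_assoc]
  simp only [fromBlocks_multiply, Matrix.zero_mul, add_zero, zero_add,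
    trace_fromBlocks, trace_add]
  have e3 : ∀ A : Matrix (Fin 1) ι ℝ, (K⁻¹ * (of fun i (_ : Fin 1) => c * K i x) * A).trace =
      (A * (K⁻¹ * (of fun i (_ : Fin 1) => c * K i x))).trace := fun A => trace_mul_comm _ _
  rw [e3]
  have e4 : ∀ r : ℝ, ∀ A : Matrix (Fin 1) ι ℝ, (of fun (_ _ : Fin 1) => r) * A = r • A := by
    intro r A; ext i j; fin_cases i; simp [mul_apply]
  have e5 : ∀ r : ℝ, ∀ A : Matrix (Fin 1) (Fin 1) ℝ, (of fun (_ _ : Fin 1) => r) * A = r • A := by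
    intro r A; ext i j; fin_cases i; simp [mul_apply]
  simp only [e4, e5, e1, Matrix.smul_mul, e2, trace_smul]
  simp [trace, ← Matrix.mul_assoc]
  field_simp
  ring

end Matrix
-- The scalar kernel and the removal of its last design point
open scoped Kronecker
open Matrix

/-- The correlation matrix of the one-dimensional stationary Ornstein–Uhlenbeck process. -/
noncomputable def ouKernel {ι : Type*} (lam : ℝ) (t : ι → ℝ) : Matrix ι ι ℝ :=
  of fun p q => Real.exp (-lam * |t p - t q|)

/-- The derivative of `ouKernel` with respect to the damping parameter. -/
noncomputable def ouKernelDeriv {ι : Type*} (lam : ℝ) (t : ι → ℝ) : Matrix ι ι ℝ :=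
  of fun p q => -|t p - t q| * Real.exp (-lam * |t p - t q|)

/-- The commutator of `diagonal t` and `ouKernel lam t`. -/
noncomputable def ouKernelComm {ι : Type*} (lam : ℝ) (t : ι → ℝ) : Matrix ι ι ℝ :=
  of fun p q => (t p - t q) * Real.exp (-lam * |t p - t q|)

theorem trace_inv_mul_submatrix {ι κ : Type*} [Fintype ι] [Fintype κ] [DecidableEq ι]
    [DecidableEq κ] (e : ι ≃ κ) (K S : Matrix κ κ ℝ) :
    ((K.submatrix e e)⁻¹ * S.submatrix e e * (K.submatrix e e)⁻¹ * S.submatrix e e).trace =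
      (K⁻¹ * S * K⁻¹ * S).trace := by
  simp only [inv_submatrix_equiv, submatrix_mul_equiv]
  exact Fintype.sum_equiv e _ _ fun _ => rfl

section

variable {n : ℕ} (lam : ℝ) (t : Fin (n + 2) → ℝ)

/-- Markov property: distances to the last point pass through the point before it, so the
correlations factor. -/
theorem exp_neg_mul_abs_last (ht : Monotone t) (i : Fin (n + 1)) :
    |t i.castSucc - t (Fin.last _)| = |t i.castSucc - t (Fin.last n).castSucc| +
        (t (Fin.last _) - t (Fin.last n).castSucc) ∧
    Real.exp (-lam * |t i.castSucc - t (Fin.last _)|) =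
      Real.exp (-lam * (t (Fin.last _) - t (Fin.last n).castSucc)) *
        Real.exp (-lam * |t i.castSucc - t (Fin.last n).castSucc|) := by
  have h1 : t i.castSucc ≤ t (Fin.last n).castSucc := ht (by simpa using Fin.le_last i)
  have h2 : t (Fin.last n).castSucc ≤ t (Fin.last _) := ht (Fin.le_last _)
  have h : |t i.castSucc - t (Fin.last _)| = |t i.castSucc - t (Fin.last n).castSucc| +
        (t (Fin.last _) - t (Fin.last n).castSucc) := by
    rw [abs_of_nonpos (by linarith), abs_of_nonpos (by linarith)]; ring
  refine ⟨h, ?_⟩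
  rw [h, ← Real.exp_add]
  ring_nf

theorem ouKernel_submatrix (ht : Monotone t) :
    (ouKernel lam t).submatrix
      (finSumFinEquiv (m := n + 1) (n := 1)) (finSumFinEquiv (m := n + 1) (n := 1)) =
      appendRow (Fin.last n) (Real.exp (-lam * (t (Fin.last _) - t (Fin.last n).castSucc))) *
        fromBlocks (ouKernel lam (t ∘ Fin.castSucc)) 0 0 (of fun _ _ => 1 -
          Real.exp (-lam * (t (Fin.last _) - t (Fin.last n).castSucc)) ^ 2) *
        (appendRow (Fin.last n)
          (Real.exp (-lam * (t (Fin.last _) - t (Fin.last n).castSucc))))ᵀ := by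
  rw [appendRow_congr]
  ext (i | i) (j | j)
  · rfl
  · fin_cases j
    change Real.exp (-lam * |t i.castSucc - t (Fin.last _)|) = _
    rw [(exp_neg_mul_abs_last lam t ht i).2]
    simp [ouKernel]
  · fin_cases i
    change Real.exp (-lam * |t (Fin.last _) - t j.castSucc|) = _
    rw [abs_sub_comm, (exp_neg_mul_abs_last lam t ht j).2]
    simp [ouKernel, abs_sub_comm]
  · fin_cases i; fin_cases j
    change Real.exp (-lam * |t (Fin.last _) - t (Fin.last _)|) = _
    simp [ouKernel]; ring

theorem ouKernelDeriv_submatrix (ht : Monotone t) (d a : ℝ)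
    (hd : d = t (Fin.last _) - t (Fin.last n).castSucc) (ha : a = Real.exp (-lam * d)) :
    (ouKernelDeriv lam t).submatrix
      (finSumFinEquiv (m := n + 1) (n := 1)) (finSumFinEquiv (m := n + 1) (n := 1)) =
      appendRow (Fin.last n) a *
        fromBlocks (ouKernelDeriv lam (t ∘ Fin.castSucc))
          (of fun i _ => (-d * a) * ouKernel lam (t ∘ Fin.castSucc) i (Fin.last n))
          (of fun _ j => 1 * ((-d * a) * ouKernel lam (t ∘ Fin.castSucc) (Fin.last n) j))
          -- The diagonal of the derivative is zero; this corner offsets the two border terms `-d *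
          -- a ^ 2` that the congruence adds to it.
          (of fun _ _ => 2 * d * a ^ 2) * (appendRow (Fin.last n) a)ᵀ := by
  rw [appendRow_congr]
  ext (i | i) (j | j)
  · rfl
  · fin_cases j
    change -|t i.castSucc - t (Fin.last _)| * Real.exp (-lam * |t i.castSucc - t (Fin.last _)|) = _
    rw [(exp_neg_mul_abs_last lam t ht i).2, (exp_neg_mul_abs_last lam t ht i).1, ← hd, ← ha]
    simp [ouKernel, ouKernelDeriv]; ring
  · fin_cases i
    change -|t (Fin.last _) - t j.castSucc| * Real.exp (-lam * |t (Fin.last _) - t j.castSucc|) = _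
    rw [abs_sub_comm, (exp_neg_mul_abs_last lam t ht j).2, (exp_neg_mul_abs_last lam t ht j).1,
      ← hd, ← ha, abs_sub_comm]
    simp [ouKernel, ouKernelDeriv]; ring
  · fin_cases i; fin_cases j
    change -|t (Fin.last _) - t (Fin.last _)| * Real.exp (-lam * |t (Fin.last _) - t (Fin.last _)|)
      = _
    simp [ouKernel, ouKernelDeriv]; ring

theorem ouKernelComm_submatrix (ht : Monotone t) (d a : ℝ)
    (hd : d = t (Fin.last _) - t (Fin.last n).castSucc) (ha : a = Real.exp (-lam * d)) :
    (ouKernelComm lam t).submatrix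
      (finSumFinEquiv (m := n + 1) (n := 1)) (finSumFinEquiv (m := n + 1) (n := 1)) =
      appendRow (Fin.last n) a *
        fromBlocks (ouKernelComm lam (t ∘ Fin.castSucc))
          (of fun i _ => (-d * a) * ouKernel lam (t ∘ Fin.castSucc) i (Fin.last n))
          (of fun _ j => -1 * ((-d * a) * ouKernel lam (t ∘ Fin.castSucc) (Fin.last n) j))
          -- By antisymmetry the two border terms cancel in the corner.
          (of fun _ _ => 0) * (appendRow (Fin.last n) a)ᵀ := by
  rw [appendRow_congr]
  ext (i | i) (j | j)
  · rfl
  · fin_cases j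
    change (t i.castSucc - t (Fin.last _)) * Real.exp (-lam * |t i.castSucc - t (Fin.last _)|) = _
    rw [(exp_neg_mul_abs_last lam t ht i).2, ← hd, ← ha]
    simp [ouKernel, ouKernelComm, hd]; ring
  · fin_cases i
    change (t (Fin.last _) - t j.castSucc) * Real.exp (-lam * |t (Fin.last _) - t j.castSucc|) = _
    rw [abs_sub_comm, (exp_neg_mul_abs_last lam t ht j).2, ← hd, ← ha, abs_sub_comm]
    simp [ouKernel, ouKernelComm, hd]; ring
  · fin_cases i; fin_cases j
    change (t (Fin.last _) - t (Fin.last _)) * Real.exp (-lam * |t (Fin.last _) - t (Fin.last _)|)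
      = _
    simp [ouKernel, ouKernelComm]

end

/-! ### Contribution of one gap, positivity and scalar traces -/

theorem one_sub_exp_sq_pos {lam d : ℝ} (hlam : 0 < lam) (hd : 0 < d) :
    0 < 1 - Real.exp (-lam * d) ^ 2 := by
  have : Real.exp (-lam * d) < 1 := Real.exp_lt_one_iff.2 (by nlinarith)
  nlinarith [Real.exp_pos (-lam * d)]

theorem phiOU_eq {lam d : ℝ} (hlam : 0 < lam) (hd : 0 < d) :
    phiOU lam d = 2 * d ^ 2 * Real.exp (-lam * d) ^ 2 / (1 - Real.exp (-lam * d) ^ 2) +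
      4 * d ^ 2 * Real.exp (-lam * d) ^ 4 / (1 - Real.exp (-lam * d) ^ 2) ^ 2 := by
  have h := one_sub_exp_sq_pos hlam hd
  have e := Real.exp_pos (-lam * d)
  rw [phiOU, if_neg hd.ne', Real.cosh_eq, Real.sinh_eq, ← neg_mul,
    show lam * d = -(-lam * d) by ring, Real.exp_neg]
  set a := Real.exp (-lam * d)
  have h2 : (a⁻¹ - a) / 2 = (1 - a ^ 2) / (2 * a) := by field_simp
  rw [h2]
  have := h.ne'
  field_simp
  ring

theorem psiOU_eq {lam d : ℝ} (hlam : 0 < lam) (hd : 0 < d) :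
    psiOU lam d = 2 * d ^ 2 * Real.exp (-lam * d) ^ 2 / (1 - Real.exp (-lam * d) ^ 2) := by
  have h := one_sub_exp_sq_pos hlam hd
  have e := Real.exp_pos (-lam * d)
  rw [psiOU, if_neg hd.ne', Real.sinh_eq, ← neg_mul,
    show lam * d = -(-lam * d) by ring, Real.exp_neg]
  set a := Real.exp (-lam * d)
  have h2 : (a⁻¹ - a) / 2 = (1 - a ^ 2) / (2 * a) := by field_simp
  rw [h2]
  have := h.ne'
  field_simp

theorem posDef_fromBlocks_diag {ι : Type*} [Fintype ι] [DecidableEq ι] {K : Matrix ι ι ℝ}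
    (hK : K.PosDef) {s : ℝ} (hs : 0 < s) :
    (fromBlocks K 0 0 (of fun _ _ => s) : Matrix (ι ⊕ Fin 1) (ι ⊕ Fin 1) ℝ).PosDef := by
  refine posDef_iff_dotProduct_mulVec.2 ⟨?_, fun {x} hx => ?_⟩
  · refine IsHermitian.fromBlocks hK.isHermitian (by simp) ?_
    ext i j; simp
  · have h := hK.posSemidef.dotProduct_mulVec_nonneg (x ∘ Sum.inl)
    have h2 : star x ⬝ᵥ (fromBlocks K 0 0 (of fun _ _ => s) : Matrix (ι ⊕ Fin 1) (ι ⊕ Fin 1) ℝ) *ᵥ x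
        = star (x ∘ Sum.inl) ⬝ᵥ K *ᵥ (x ∘ Sum.inl) + s * x (Sum.inr 0) ^ 2 := by
      simp [dotProduct, mulVec]; ring
    rw [h2]
    by_cases h0 : x (Sum.inr 0) = 0
    · have : x ∘ Sum.inl ≠ 0 := by
        rintro h3
        apply hx
        ext (i | i)
        · exact congrFun h3 i
        · fin_cases i; exact h0
      have := hK.dotProduct_mulVec_pos this
      simpa [h0] using this
    · have : 0 < s * x (Sum.inr 0) ^ 2 := by positivity
      linarith

theorem posDef_ouKernel {lam : ℝ} (hlam : 0 < lam) :
    ∀ {n : ℕ} (t : Fin n → ℝ), StrictMono t → (ouKernel lam t).PosDef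
  | 0, t, _ => by
    rw [Subsingleton.elim (ouKernel lam t) 1]; exact PosDef.one
  | 1, t, _ => by
    -- One point is a separate base case, because the recursion needs a predecessor of the last
    -- point.
    have : ouKernel lam t = 1 := by ext i j; fin_cases i; fin_cases j; simp [ouKernel]
    rw [this]; exact PosDef.one
  | n + 2, t, ht => by
    have hu : StrictMono (t ∘ Fin.castSucc) := ht.comp Fin.strictMono_castSucc
    have hd : 0 < t (Fin.last _) - t (Fin.last n).castSucc :=
      sub_pos.2 (ht (Fin.castSucc_lt_last _))
    have h := posDef_congr _ _ (isUnit_det_appendRow (Fin.last n)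
      (Real.exp (-lam * (t (Fin.last _) - t (Fin.last n).castSucc))))
      (posDef_fromBlocks_diag (posDef_ouKernel hlam _ hu) (one_sub_exp_sq_pos hlam hd))
    rw [← ouKernel_submatrix lam t ht.monotone] at h
    have h2 := h.submatrix (e := finSumFinEquiv.symm) finSumFinEquiv.symm.injective
    simpa using h2

theorem trace_ouKernelDeriv {lam : ℝ} (hlam : 0 < lam) :
    ∀ {n : ℕ} (t : Fin (n + 1) → ℝ), StrictMono t →
      ((ouKernel lam t)⁻¹ * ouKernelDeriv lam t * (ouKernel lam t)⁻¹ * ouKernelDeriv lam t).trace =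
        ∑ l : Fin n, phiOU lam (t l.succ - t l.castSucc)
  | 0, t, _ => by
    have : ouKernelDeriv lam t = 0 := by ext i j; fin_cases i; fin_cases j; simp [ouKernelDeriv]
    simp [this]
  | n + 1, t, ht => by
    have hu : StrictMono (t ∘ Fin.castSucc) := ht.comp Fin.strictMono_castSucc
    have hd : 0 < t (Fin.last _) - t (Fin.last n).castSucc :=
      sub_pos.2 (ht (Fin.castSucc_lt_last _))
    rw [← trace_inv_mul_submatrix finSumFinEquiv, ouKernel_submatrix lam t ht.monotone,
      ouKernelDeriv_submatrix lam t ht.monotone _ _ rfl rfl,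
      trace_inv_mul_congr _ _ _ _ (isUnit_det_appendRow _ _),
      trace_bordered _ _ _ (posDef_ouKernel hlam _ hu).det_pos.ne'.isUnit (by simp [ouKernel]) _ _ _ _
        (one_sub_exp_sq_pos hlam hd).ne', trace_ouKernelDeriv hlam _ hu, Fin.sum_univ_castSucc,
      Fin.succ_last, phiOU_eq hlam hd, add_assoc]
    congr 1
    ring

theorem trace_ouKernelComm {lam : ℝ} (hlam : 0 < lam) :
    ∀ {n : ℕ} (t : Fin (n + 1) → ℝ), StrictMono t →
      ((ouKernel lam t)⁻¹ * ouKernelComm lam t * (ouKernel lam t)⁻¹ * ouKernelComm lam t).trace =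
        -∑ l : Fin n, psiOU lam (t l.succ - t l.castSucc)
  | 0, t, _ => by
    have : ouKernelComm lam t = 0 := by ext i j; fin_cases i; fin_cases j; simp [ouKernelComm]
    simp [this]
  | n + 1, t, ht => by
    have hu : StrictMono (t ∘ Fin.castSucc) := ht.comp Fin.strictMono_castSucc
    have hd : 0 < t (Fin.last _) - t (Fin.last n).castSucc :=
      sub_pos.2 (ht (Fin.castSucc_lt_last _))
    rw [← trace_inv_mul_submatrix finSumFinEquiv, ouKernel_submatrix lam t ht.monotone,
      ouKernelComm_submatrix lam t ht.monotone _ _ rfl rfl,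
      trace_inv_mul_congr _ _ _ _ (isUnit_det_appendRow _ _),
      trace_bordered _ _ _ (posDef_ouKernel hlam _ hu).det_pos.ne'.isUnit (by simp [ouKernel]) _ _ _ _
        (one_sub_exp_sq_pos hlam hd).ne', trace_ouKernelComm hlam _ hu, Fin.sum_univ_castSucc,
      Fin.succ_last, psiOU_eq hlam hd, neg_add, add_assoc]
    congr 1
    ring

/-! ### Rotations and the planar factor -/

/-- The rotation of the plane by the angle `θ`. -/
noncomputable def planeRot (θ : ℝ) : Matrix (Fin 2) (Fin 2) ℝ :=
  !![Real.cos θ, -Real.sin θ; Real.sin θ, Real.cos θ]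

/-- The rotation of the plane by a right angle. -/
def quarterTurn : Matrix (Fin 2) (Fin 2) ℝ :=
  !![0, -1; 1, 0]

theorem planeRot_mul_transpose (a b : ℝ) : planeRot a * (planeRot b)ᵀ = planeRot (a - b) := by
  ext i j
  fin_cases i <;> fin_cases j <;>
    simp [planeRot, mul_apply, Real.cos_sub, Real.sin_sub] <;> ring

/-- The derivative of a rotation is the rotation times a quarter turn. Splitting the angle between
left and right factors gives the form that `blockRot` congruences produce. -/
theorem hasDerivAt_planeRot (c a b x : ℝ) (h : c = a - b) (i j : Fin 2) :
    HasDerivAt (fun o => planeRot (o * c) i j)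
      (c * (planeRot (x * a) * quarterTurn * (planeRot (x * b))ᵀ) i j) x := by
  have h1 : HasDerivAt (fun o : ℝ => o * c) c x := hasDerivAt_mul_const c
  have hc := h1.cos
  have hs := h1.sin
  have e : x * c = x * a - x * b := by rw [h]; ring
  fin_cases i <;> fin_cases j
  · refine hc.congr_deriv ?_
    rw [e, Real.sin_sub]
    simp [planeRot, quarterTurn, mul_apply]; ring
  · refine hs.neg.congr_deriv ?_
    rw [e, Real.cos_sub]
    simp [planeRot, quarterTurn, mul_apply]; ring
  · refine hs.congr_deriv ?_
    rw [e, Real.cos_sub]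
    simp [planeRot, quarterTurn, mul_apply]; ring
  · refine hc.congr_deriv ?_
    rw [e, Real.sin_sub]
    simp [planeRot, quarterTurn, mul_apply]; ring

section

variable {ι : Type*} [Fintype ι] [DecidableEq ι]

/-- The block diagonal matrix of the rotations by the angles `θ p`. -/
noncomputable def blockRot (θ : ι → ℝ) : Matrix (ι × Fin 2) (ι × Fin 2) ℝ :=
  of fun p q => if p.1 = q.1 then planeRot (θ p.1) p.2 q.2 else 0

theorem blockRot_congr_apply (θ : ι → ℝ) (M : Matrix ι ι ℝ) (X : Matrix (Fin 2) (Fin 2) ℝ)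
    (p q : ι × Fin 2) :
    (blockRot θ * (M ⊗ₖ X) * (blockRot θ)ᵀ) p q =
      M p.1 q.1 * (planeRot (θ p.1) * X * (planeRot (θ q.1))ᵀ) p.2 q.2 := by
  simp [mul_apply, blockRot, Fintype.sum_prod_type, ite_mul, mul_ite]
  ring

theorem isUnit_det_blockRot (θ : ι → ℝ) : IsUnit (blockRot θ).det := by
  refine isUnit_det_of_right_inverse (B := (blockRot θ)ᵀ) ?_
  rw [← Matrix.mul_one (blockRot θ), ← one_kronecker_one]
  ext ⟨p, i⟩ ⟨q, j⟩
  rw [transpose_mul]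
  have := blockRot_congr_apply θ 1 1 (p, i) (q, j)
  simp only [one_kronecker_one, Matrix.mul_one, transpose_one, Matrix.one_mul] at this ⊢
  rw [this, planeRot_mul_transpose]
  by_cases h : p = q
  · subst h
    fin_cases i <;> fin_cases j <;> simp [planeRot]
  · simp [h]

theorem fisherEntry_blockRot (θ : ι → ℝ) (K A B : Matrix ι ι ℝ) (X Y : Matrix (Fin 2) (Fin 2) ℝ) :
    fisherEntry (blockRot θ * (K ⊗ₖ 1) * (blockRot θ)ᵀ) (blockRot θ * (A ⊗ₖ X) * (blockRot θ)ᵀ)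
      (blockRot θ * (B ⊗ₖ Y) * (blockRot θ)ᵀ) =
      1 / 2 * ((K⁻¹ * A * K⁻¹ * B).trace * (X * Y).trace) := by
  rw [fisherEntry, trace_inv_mul_congr _ _ _ _ (isUnit_det_blockRot θ), inv_kronecker, inv_one,
    ← mul_kronecker_mul, ← mul_kronecker_mul, ← mul_kronecker_mul, trace_kronecker]
  simp

end

/-! ### The covariance matrix of the observations and its derivatives -/

theorem IsStationaryOU.obsCov_constTrend {Ω : Type*} [MeasurableSpace Ω] {P : Measure Ω}
    {l o : ℝ} {Y : ℝ≥0 → Ω → EuclideanSpace ℝ (Fin 2)} (hl : 0 < l)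
    (hY : IsStationaryOU l o (Real.sqrt (2 * l)) Y P) (m : EuclideanSpace ℝ (Fin 2)) {n : ℕ}
    (t : Fin n → ℝ≥0) (p q : Fin n × Fin 2) :
    obsCov (constTrend m Y) P t p q = Real.exp (-l * |(t p.1 : ℝ) - t q.1|) *
      planeRot (o * ((t p.1 : ℝ) - t q.1)) p.2 q.2 := by
  have := hY.gaussian.isProbabilityMeasure
  have hmem : ∀ (s : ℝ≥0) (i : Fin 2), MemLp (fun w => Y s w i) 2 P := fun s i =>
    ((hY.gaussian.hasGaussianLaw_eval s).map
      (EuclideanSpace.proj i : EuclideanSpace ℝ (Fin 2) →L[ℝ] ℝ)).memLp_two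
  have hint : ∀ (s : ℝ≥0) (i : Fin 2), Integrable (fun w => Y s w i) P := fun s i =>
    (hmem s i).integrable (by norm_num)
  have hcov : ∀ (s u : ℝ≥0) (i j : Fin 2), s ≤ u →
      cov[fun w => Y u w i, fun w => Y s w j; P] =
        Real.exp (-l * |(u : ℝ) - s|) * planeRot (o * ((u : ℝ) - s)) i j := by
    intro s u i j hsu
    rw [covariance_eq_sub (hmem u i) (hmem s j), hY.centered, hY.centered]
    have h := hY.cov_eq s (u - s) i j
    rw [add_tsub_cancel_of_le hsu] at h
    have hsq : Real.sqrt (2 * l) ^ 2 / (2 * l) = 1 := by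
      rw [Real.sq_sqrt (by positivity), div_self (by positivity)]
    have hc : ((u - s : ℝ≥0) : ℝ) = u - s := NNReal.coe_sub hsu
    have hn : (0 : ℝ) ≤ (u : ℝ) - s := sub_nonneg.2 (by exact_mod_cast hsu)
    rw [abs_of_nonneg hn]
    simp only [Pi.mul_apply, mul_zero, sub_zero]
    rw [h, ouCov, hsq, hc, one_mul]
    rfl
  have hadd : obsCov (constTrend m Y) P t p q =
      cov[fun w => Y (t p.1) w p.2, fun w => Y (t q.1) w q.2; P] := by
    simp only [obsCov, constTrend, of_apply, PiLp.add_apply]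
    rw [covariance_const_add_left (hint _ _), covariance_const_add_right (hint _ _)]
  rw [hadd]
  -- The defining covariance is given only for the later time first; the other order follows since
  -- rotation by the opposite angle is the transpose.
  rcases le_total (t q.1) (t p.1) with h | h
  · exact hcov _ _ _ _ h
  · rw [covariance_comm, hcov _ _ _ _ h, abs_sub_comm,
      show o * ((t q.1 : ℝ) - t p.1) = -(o * ((t p.1 : ℝ) - t q.1)) by ring]
    congr 1
    generalize p.2 = i
    generalize q.2 = j
    fin_cases i <;> fin_cases j <;> simp [planeRot]

theorem obsCov_eq_blockRot {Ω : Type*} [MeasurableSpace Ω] {P : ℝ → ℝ → Measure Ω}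
    {Y : ℝ → ℝ → ℝ≥0 → Ω → EuclideanSpace ℝ (Fin 2)}
    (hY : ∀ l o : ℝ, 0 < l → o ≠ 0 → IsStationaryOU l o (Real.sqrt (2 * l)) (Y l o) (P l o))
    (m : EuclideanSpace ℝ (Fin 2)) {n : ℕ} (t : Fin n → ℝ≥0) {lam om : ℝ} (hlam : 0 < lam)
    (hom : om ≠ 0) :
    obsCov (constTrend m (Y lam om)) (P lam om) t =
      blockRot (fun p => om * (t p : ℝ)) * (ouKernel lam (fun p => (t p : ℝ)) ⊗ₖ
        (1 : Matrix (Fin 2) (Fin 2) ℝ)) *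
        (blockRot (fun p => om * (t p : ℝ)))ᵀ := by
  ext p q
  rw [blockRot_congr_apply, Matrix.mul_one, planeRot_mul_transpose,
    (hY lam om hlam hom).obsCov_constTrend hlam, mul_sub]
  rfl

theorem hasDerivAt_obsCov_lam {Ω : Type*} [MeasurableSpace Ω] {P : ℝ → ℝ → Measure Ω}
    {Y : ℝ → ℝ → ℝ≥0 → Ω → EuclideanSpace ℝ (Fin 2)}
    (hY : ∀ l o : ℝ, 0 < l → o ≠ 0 → IsStationaryOU l o (Real.sqrt (2 * l)) (Y l o) (P l o))
    (m : EuclideanSpace ℝ (Fin 2)) {n : ℕ} (t : Fin n → ℝ≥0) {lam om : ℝ} (hlam : 0 < lam)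
    (hom : om ≠ 0) (p q : Fin n × Fin 2) :
    HasDerivAt (fun l => obsCov (constTrend m (Y l om)) (P l om) t p q)
      ((blockRot (fun p => om * (t p : ℝ)) * (ouKernelDeriv lam (fun p => (t p : ℝ)) ⊗ₖ
        (1 : Matrix (Fin 2) (Fin 2) ℝ)) *
        (blockRot (fun p => om * (t p : ℝ)))ᵀ) p q) lam := by
  -- The covariance formula is available only for positive damping, hence only near `lam`.
  have he : (fun l => obsCov (constTrend m (Y l om)) (P l om) t p q) =ᶠ[nhds lam]
      fun l => Real.exp (-l * |(t p.1 : ℝ) - t q.1|) *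
        planeRot (om * ((t p.1 : ℝ) - t q.1)) p.2 q.2 := by
    filter_upwards [lt_mem_nhds hlam] with l hl
    exact (hY l om hl hom).obsCov_constTrend hl m t p q
  refine HasDerivAt.congr_of_eventuallyEq ?_ he
  have h := (((hasDerivAt_neg lam).mul_const |(t p.1 : ℝ) - t q.1|).exp).mul_const
    (planeRot (om * ((t p.1 : ℝ) - t q.1)) p.2 q.2)
  refine h.congr_deriv ?_
  rw [blockRot_congr_apply, Matrix.mul_one, planeRot_mul_transpose, mul_sub]
  simp only [ouKernelDeriv, of_apply]
  ring

theorem hasDerivAt_obsCov_om {Ω : Type*} [MeasurableSpace Ω] {P : ℝ → ℝ → Measure Ω}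
    {Y : ℝ → ℝ → ℝ≥0 → Ω → EuclideanSpace ℝ (Fin 2)}
    (hY : ∀ l o : ℝ, 0 < l → o ≠ 0 → IsStationaryOU l o (Real.sqrt (2 * l)) (Y l o) (P l o))
    (m : EuclideanSpace ℝ (Fin 2)) {n : ℕ} (t : Fin n → ℝ≥0) {lam om : ℝ} (hlam : 0 < lam)
    (hom : om ≠ 0) (p q : Fin n × Fin 2) :
    HasDerivAt (fun o => obsCov (constTrend m (Y lam o)) (P lam o) t p q)
      ((blockRot (fun p => om * (t p : ℝ)) *
        (ouKernelComm lam (fun p => (t p : ℝ)) ⊗ₖ quarterTurn) *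
        (blockRot (fun p => om * (t p : ℝ)))ᵀ) p q) om := by
  have he : (fun o => obsCov (constTrend m (Y lam o)) (P lam o) t p q) =ᶠ[nhds om]
      fun o => Real.exp (-lam * |(t p.1 : ℝ) - t q.1|) *
        planeRot (o * ((t p.1 : ℝ) - t q.1)) p.2 q.2 := by
    filter_upwards [isOpen_ne.mem_nhds hom] with o ho
    exact (hY lam o hlam ho).obsCov_constTrend hlam m t p q
  refine HasDerivAt.congr_of_eventuallyEq ?_ he
  have h := (hasDerivAt_planeRot ((t p.1 : ℝ) - t q.1) (t p.1) (t q.1) om rfl p.2 q.2).const_mul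
    (Real.exp (-lam * |(t p.1 : ℝ) - t q.1|))
  refine h.congr_deriv ?_
  rw [blockRot_congr_apply]
  simp only [ouKernelComm, of_apply]
  ring

/-! ### Assembly of the information matrix -/

theorem trace_ouKernelDeriv_gap {lam : ℝ} (hlam : 0 < lam) {n : ℕ} (t : Fin n → ℝ≥0)
    (ht : StrictMono t) :
    ((ouKernel lam fun p => (t p : ℝ))⁻¹ * ouKernelDeriv lam (fun p => (t p : ℝ)) *
      (ouKernel lam fun p => (t p : ℝ))⁻¹ * ouKernelDeriv lam (fun p => (t p : ℝ))).trace =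
      ∑ l : Fin (n - 1), phiOU lam (gap t l) := by
  cases n with
  | zero => simp [trace]
  | succ n => exact trace_ouKernelDeriv hlam _ (fun _ _ h => NNReal.coe_lt_coe.2 (ht h))

theorem trace_ouKernelComm_gap {lam : ℝ} (hlam : 0 < lam) {n : ℕ} (t : Fin n → ℝ≥0)
    (ht : StrictMono t) :
    ((ouKernel lam fun p => (t p : ℝ))⁻¹ * ouKernelComm lam (fun p => (t p : ℝ)) *
      (ouKernel lam fun p => (t p : ℝ))⁻¹ * ouKernelComm lam (fun p => (t p : ℝ))).trace =
      -∑ l : Fin (n - 1), psiOU lam (gap t l) := by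
  cases n with
  | zero => simp [trace]
  | succ n => exact trace_ouKernelComm hlam _ (fun _ _ h => NNReal.coe_lt_coe.2 (ht h))

/-- For every `λ > 0`, `ω ≠ 0` let `Y λ ω` be, under `P λ ω`, a stationary OU process with these
parameters and `σ² / (2 λ) = 1`, and let `C λ ω` be the covariance matrix of the observations of
`m + Y λ ω` in the design points `t`. -/
theorem theorem2 {Ω : Type*} [MeasurableSpace Ω] (P : ℝ → ℝ → Measure Ω)
    (Y : ℝ → ℝ → ℝ≥0 → Ω → EuclideanSpace ℝ (Fin 2))
    (hY : ∀ l o : ℝ, 0 < l → o ≠ 0 → IsStationaryOU l o (Real.sqrt (2 * l)) (Y l o) (P l o))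
    (m : EuclideanSpace ℝ (Fin 2)) (n : ℕ) (t : Fin n → ℝ≥0) (ht : StrictMono t)
    (C : ℝ → ℝ → Matrix (Fin n × Fin 2) (Fin n × Fin 2) ℝ)
    (hC : C = fun l o => obsCov (constTrend m (Y l o)) (P l o) t)
    (lam om : ℝ) (hlam : 0 < lam) (hom : om ≠ 0) :
    -- the quantities that enter the information matrix are well defined
    (C lam om).PosDef ∧
    (∀ p q, DifferentiableAt ℝ (fun l => C l om p q) lam ∧
      DifferentiableAt ℝ (fun o => C lam o p q) om) ∧
    -- the entries of the information matrix
    fisherEntry (C lam om) (matDerivLam C lam om) (matDerivLam C lam om) =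
      ∑ l : Fin (n - 1), phiOU lam (gap t l) ∧
    fisherEntry (C lam om) (matDerivOm C lam om) (matDerivOm C lam om) =
      ∑ l : Fin (n - 1), psiOU lam (gap t l) ∧
    fisherEntry (C lam om) (matDerivLam C lam om) (matDerivOm C lam om) = 0 ∧
    -- the information matrix does not depend on the frequency
    (∀ om' : ℝ, om' ≠ 0 → fisherMatrix C lam om' = fisherMatrix C lam om) := by

  subst hC
  have hdL : ∀ o, o ≠ 0 → matDerivLam (fun l o => obsCov (constTrend m (Y l o)) (P l o) t) lam o =
      blockRot (fun p => o * (t p : ℝ)) * (ouKernelDeriv lam (fun p => (t p : ℝ)) ⊗ₖ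
        (1 : Matrix (Fin 2) (Fin 2) ℝ)) *
        (blockRot (fun p => o * (t p : ℝ)))ᵀ := by
    intro o ho
    ext p q
    exact (hasDerivAt_obsCov_lam hY m t hlam ho p q).deriv
  have hdO : ∀ o, o ≠ 0 → matDerivOm (fun l o => obsCov (constTrend m (Y l o)) (P l o) t) lam o =
      blockRot (fun p => o * (t p : ℝ)) *
        (ouKernelComm lam (fun p => (t p : ℝ)) ⊗ₖ quarterTurn) *
        (blockRot (fun p => o * (t p : ℝ)))ᵀ := by
    intro o ho
    ext p q
    exact (hasDerivAt_obsCov_om hY m t hlam ho p q).deriv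
  have hLL : ∀ o, o ≠ 0 → fisherEntry (obsCov (constTrend m (Y lam o)) (P lam o) t)
      (matDerivLam (fun l o => obsCov (constTrend m (Y l o)) (P l o) t) lam o)
      (matDerivLam (fun l o => obsCov (constTrend m (Y l o)) (P l o) t) lam o) =
      ∑ l : Fin (n - 1), phiOU lam (gap t l) := by
    intro o ho
    rw [hdL o ho, obsCov_eq_blockRot hY m t hlam ho, fisherEntry_blockRot,
      trace_ouKernelDeriv_gap hlam t ht]
    simp [trace]
    ring
  have hOO : ∀ o, o ≠ 0 → fisherEntry (obsCov (constTrend m (Y lam o)) (P lam o) t)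
      (matDerivOm (fun l o => obsCov (constTrend m (Y l o)) (P l o) t) lam o)
      (matDerivOm (fun l o => obsCov (constTrend m (Y l o)) (P l o) t) lam o) =
      ∑ l : Fin (n - 1), psiOU lam (gap t l) := by
    intro o ho
    rw [hdO o ho, obsCov_eq_blockRot hY m t hlam ho, fisherEntry_blockRot,
      trace_ouKernelComm_gap hlam t ht]
    -- The square of the quarter turn has trace -2, which cancels the factor 1/2 and the minus sign
    -- of the commutator trace.
    simp [trace, quarterTurn]
    ring
  have hLO : ∀ o, o ≠ 0 → fisherEntry (obsCov (constTrend m (Y lam o)) (P lam o) t)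
      (matDerivLam (fun l o => obsCov (constTrend m (Y l o)) (P l o) t) lam o)
      (matDerivOm (fun l o => obsCov (constTrend m (Y l o)) (P l o) t) lam o) = 0 := by
    intro o ho
    rw [hdL o ho, hdO o ho, obsCov_eq_blockRot hY m t hlam ho, fisherEntry_blockRot]
    simp [trace, quarterTurn]
  refine ⟨?_, fun p q => ⟨(hasDerivAt_obsCov_lam hY m t hlam hom p q).differentiableAt,
    (hasDerivAt_obsCov_om hY m t hlam hom p q).differentiableAt⟩, hLL om hom, hOO om hom,
    hLO om hom, fun om' hom' => ?_⟩
  · simp only [obsCov_eq_blockRot hY m t hlam hom]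
    exact posDef_congr _ _ (isUnit_det_blockRot _)
      ((posDef_ouKernel hlam _ (fun _ _ h => NNReal.coe_lt_coe.2 (ht h))).kronecker PosDef.one)
  · simp only [fisherMatrix, hLL om hom, hOO om hom, hLO om hom, hLL om' hom', hOO om' hom',
      hLO om' hom']
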